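/- **The $B$ model.** A network is a connected undirected simple graph $G$ whose vertices are processors of unbounded computational power. They compute in synchronous rounds; in each round every vertex may send a message of at most $B$ bits along each incident edge, in each direction, and then updates its state. The programs are deterministic and may depend on the vertex and on $G$. In a *verification problem* for a property $\Pi$, the input is a subgraph $H=(V(G),E')$ with $E'\subseteq E(G)$, where every vertex initially knows which of its incident edges belong to $H$. An algorithm *verifies $\Pi$ on $G$* if, for every such $H$, every vertex eventually writes an irrevocable output bit, and this bit is $1$ if and only if $H$ satisfies $\Pi$. Its *running time on $G$* is the maximum, over all $H$, of the number of rounds until all vertices have written their outputs. **Theorem 6.1.** There are absolute constants $c,c_1,c_2>0$ such that the following holds for all integers $p\ge 1$, $B\ge 1$ and all $n\in\{d^{2p+1}pB : d=2,3,4,\dots\}$. There is a connected graph $G$ of diameter exactly $2p+2$, with $c_1 n\le |V(G)|\le c_2 n$, on which every deterministic $B$-model algorithm that verifies any one of the following properties has running time at least $$c\left(\frac{n}{pB}\right)^{\frac12-\frac1{2(2p+1)}}.$$ 1. *Hamiltonian cycle:* $H$ is a simple cycle of length $|V(G)|$. 2. *Spanning tree:* $H$ is a tree spanning all vertices of $G$.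 3. *Simple path:* exactly two vertices have degree one in $H$, all other vertices have degree zero or two in $H$, and $H$ contains no cycle. -/

import Mathlib

/-- A message of the `B` model: a string of at most `B` bits
(the empty string stands for sending nothing). -/
abbrev BMessage (B : ℕ) : Type := {l : List Bool // l.length ≤ B}

/-- A deterministic distributed algorithm on the network `G` in the `B` model.
Every vertex is a processor with its own, arbitrary (computationally unbounded) program; the
programs may depend on the vertex and on the whole network `G`.  The input of a vertex `v` is one
Boolean indicator variable for every neighbour of `v`.  In every synchronous round each vertex
sends one message of at most `B` bits over each of its incident edges and then updates its state.
A vertex may write its Boolean output variable after any round, and an output is never revoked. -/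
structure BAlgorithm {V : Type} (G : SimpleGraph V) (B : ℕ) where
  /-- local states of the processors -/
  State : Type
  /-- the initial state of a vertex, computed from its local input -/
  init : (v : V) → (G.neighborSet v → Bool) → State
  /-- the message that a vertex in a given state sends to a given neighbour -/
  send : (v : V) → State → G.neighborSet v → BMessage B
  /-- the new state of a vertex, computed from its old state and the messages received -/
  receive : (v : V) → State → (G.neighborSet v → BMessage B) → State
  /-- the output variable of a vertex (`none` as long as it is not written) -/
  output : V → State → Option Bool
  /-- outputs are final -/
  output_final : ∀ (v : V) (s : State) (m : G.neighborSet v → BMessage B) (b : Bool),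
    output v s = some b → output v (receive v s m) = some b

namespace BAlgorithm

variable {V : Type} {G : SimpleGraph V} {B : ℕ}

open Classical in
/-- `A.run H t v` is the state of the vertex `v` after `t` rounds of the execution of `A` on the
input subgraph `H`: initially `v` knows exactly which of its incident edges belong to `H`. -/
noncomputable def run (A : BAlgorithm G B) (H : SimpleGraph V) : ℕ → V → A.State
  | 0, v => A.init v (fun w => decide (H.Adj v w))
  | t + 1, v =>
      A.receive v (A.run H t v) (fun w => A.send w (A.run H t w) ⟨v, G.adj_symm w.2⟩)

/-- `A` verifies the predicate `P`: for every subgraph `H` of `G`, all vertices eventually know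
whether `H` satisfies `P`. -/
def Verifies (A : BAlgorithm G B) (P : SimpleGraph V → Prop) : Prop :=
  ∀ H : SimpleGraph V, H ≤ G → ∀ v : V, ∃ (t : ℕ) (b : Bool),
    A.output v (A.run H t v) = some b ∧ (b = true ↔ P H)

/-- The worst-case running time of `A` is at most `T`: for every input subgraph `H` of `G`,
all vertices have written their output after `T` rounds. -/
def RunsIn (A : BAlgorithm G B) (T : ℕ) : Prop :=
  ∀ H : SimpleGraph V, H ≤ G → ∀ v : V, (A.output v (A.run H T v)).isSome = true

end BAlgorithm

/-- Every deterministic `B`-model algorithm on `G` that verifies the predicate `P` has worst-case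
running time at least `L`. -/
def RequiresTime {V : Type} (G : SimpleGraph V) (B : ℕ) (P : SimpleGraph V → Prop) (L : ℝ) :
    Prop :=
  ∀ A : BAlgorithm G B, A.Verifies P → ∀ T : ℕ, A.RunsIn T → L ≤ (T : ℝ)

/-- `H` is a Hamiltonian cycle: its edges are exactly those of one simple cycle whose length is the
number of vertices. -/
def IsHamiltonianCycleGraph {V : Type} (H : SimpleGraph V) : Prop :=
  ∃ (a : V) (c : H.Walk a a), c.IsCycle ∧ c.length = Nat.card V ∧ ∀ e ∈ H.edgeSet, e ∈ c.edges

/-- `H` is a simple path: all vertices have degree zero or two in `H`, except two vertices that have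
degree one, and there is no cycle in `H`. -/
def IsSimplePathGraph {V : Type} (H : SimpleGraph V) : Prop :=
  H.IsAcyclic ∧ ∃ a b : V, a ≠ b ∧ (H.neighborSet a).ncard = 1 ∧ (H.neighborSet b).ncard = 1 ∧
    ∀ v : V, v ≠ a → v ≠ b → (H.neighborSet v).ncard = 0 ∨ (H.neighborSet v).ncard = 2

/-!
Write `ℓ = d ^ p` and `Γ = d ^ (p + 1) p B`, so that `Γ ℓ = n` and the bound to be proved is
`T ≥ c ℓ`.  The network carries `4 Γ` long paths ("strands") of `ℓ` vertices, one vertex for each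
position `0, …, ℓ - 1`, and above the positions a complete `d`-ary tree of depth `p` whose `j`-th leaf
is joined to all strands at position `j`.

The inputs `inputGraph p Γ d x y` are indexed by two vectors of `Γ` bits.  They contain all strands,
all levels of the tree (as horizontal paths, each right end joined to the left end of the next level)
and a path `line` that returns from the root to the end of the strands.  The bits of `x` decide how the
strands are joined at position `ℓ - 1` and the bits of `y` how they are joined at position `0`.  Every
input is two-regular.  If `x = y`, it is a single Hamiltonian cycle (`inputGraph_self_connected`);
if `x i ≠ y i`, two strands of bit `i` close up to a separate cycle (`inputGraph_not_preconnected`).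
Removing a fixed edge gives inputs that are Hamiltonian paths, so spanning trees and simple paths, for
`x = y`, and that contain a cycle for `x ≠ y`.  So verifying any of the three properties decides
whether `x = y`.

Only the tree allows information to move faster than one position per round.  A tree vertex occupies
the interval of positions below it, and at most `(p + 1) (d + 4)` directed edges jump over any given
position (`exists_slotLo`, `exists_slotHi`).  An algorithm that runs for `T < ℓ / 2` rounds therefore
sends at most `2 T (p + 1) (d + 4)` messages that matter.  If these agree in the executions on `(x, x)`
and `(y, y)`, then the execution on the hybrid `(x, y)` is locally indistinguishable from one of the
two at every vertex (`BAlgorithm.run_hybrid`), which is impossible for `x ≠ y`.  So the `2 ^ Γ` inputs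
have distinct transcripts, and `Γ ≤ 4 T (p + 1) (d + 4) B` (`BAlgorithm.card_le_of_fooling`).

The diameter is exact because of `line`, which has a vertex at distance `p + 1` from the root and, on
the other side, distance `2 p + 2` from the strands: the function `Strand.height` changes by at most one
along every edge and differs by `2 p + 2` between this vertex and the strands, while every vertex is
within distance `p + 1` of the root.
-/

/-! ### Simulating a hybrid execution -/

/-- The bits of a message of at most `B` bits, with `none` past its end. -/
def BMessage.bits {B : ℕ} (m : BMessage B) : Fin B → Option Bool := fun i => m.1[(i : ℕ)]?

theorem BMessage.bits_injective {B : ℕ} : Function.Injective (BMessage.bits (B := B)) := by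
  intro m m' h
  refine Subtype.ext (List.ext_getElem? fun i => ?_)
  by_cases hi : i < B
  · exact congrFun h ⟨i, hi⟩
  · rw [List.getElem?_eq_none (by have := m.2; omega), List.getElem?_eq_none (by have := m'.2; omega)]

namespace BAlgorithm

variable {V : Type} {G : SimpleGraph V} {B : ℕ}

/-- Here `Hxx` and `Hyy` are two inputs and `Hxy` is a hybrid, which looks like `Hxx` to the vertices
with `0 < hi v` and like `Hyy` to those with `lo v < ℓ`.  Both regions shrink by one position per
round, and together they cover the network for `ℓ / 2` rounds.  As long as the two pure executions
agree on the messages that jump over the boundary of a region, a vertex of either region cannot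
distinguish the hybrid execution from the corresponding pure one. -/
theorem run_hybrid (A : BAlgorithm G B) {Hxx Hxy Hyy : SimpleGraph V} {lo hi : V → ℕ} {ℓ T : ℕ}
    (hlh : ∀ v, lo v ≤ hi v) (hT : 2 * T ≤ ℓ)
    (hX : ∀ v, 0 < hi v → ∀ w, Hxy.Adj v w ↔ Hxx.Adj v w)
    (hY : ∀ v, lo v < ℓ → ∀ w, Hxy.Adj v w ↔ Hyy.Adj v w)
    (hmsg : ∀ t < T, ∀ v w (h : G.Adj v w),
      (lo v < ℓ - (t + 1) ∧ ℓ - (t + 1) < lo w) ∨ (hi w < t + 1 ∧ t + 1 < hi v) →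
      A.send w (A.run Hxx t w) ⟨v, h.symm⟩ = A.send w (A.run Hyy t w) ⟨v, h.symm⟩) :
    ∀ t ≤ T, ∀ v, (t < hi v → A.run Hxy t v = A.run Hxx t v) ∧
      (lo v + t < ℓ → A.run Hxy t v = A.run Hyy t v) := by
  intro t
  induction t with
  | zero =>
    intro _ v
    refine ⟨fun h => ?_, fun h => ?_⟩
    · unfold run
      congr 1
      funext w
      exact decide_eq_decide.2 (hX v h w)
    · unfold run
      congr 1
      funext w
      exact decide_eq_decide.2 (hY v h w)
  | succ t ih =>
    intro ht v
    have ih := ih (by omega)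
    refine ⟨fun h => ?_, fun h => ?_⟩
    · have key : ∀ w (hw : G.Adj v w), A.send w (A.run Hxy t w) ⟨v, hw.symm⟩
          = A.send w (A.run Hxx t w) ⟨v, hw.symm⟩ := by
        intro w hw
        by_cases h' : t < hi w
        · rw [(ih w).1 h']
        · have := hlh w
          rw [(ih w).2 (by omega), hmsg t (by omega) v w hw (Or.inr ⟨by omega, h⟩)]
      simp only [run]
      rw [(ih v).1 (by omega)]
      congr 1
      funext w
      exact key w w.2
    · have key : ∀ w (hw : G.Adj v w), A.send w (A.run Hxy t w) ⟨v, hw.symm⟩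
          = A.send w (A.run Hyy t w) ⟨v, hw.symm⟩ := by
        intro w hw
        by_cases h' : lo w + t < ℓ
        · rw [(ih w).2 h']
        · have := hlh w
          rw [(ih w).1 (by omega), hmsg t (by omega) v w hw (Or.inl ⟨by omega, by omega⟩)]
      simp only [run]
      rw [(ih v).2 (by omega)]
      congr 1
      funext w
      exact key w w.2

theorem output_run_mono (A : BAlgorithm G B) (H : SimpleGraph V) (v : V) {b : Bool} {t t' : ℕ}
    (h : t ≤ t') (hb : A.output v (A.run H t v) = some b) :
    A.output v (A.run H t' v) = some b := by
  induction t', h using Nat.le_induction with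
  | base => exact hb
  | succ n _ ih => exact A.output_final _ _ _ _ ih

theorem Verifies.output_eq {A : BAlgorithm G B} {P : SimpleGraph V → Prop} (hA : A.Verifies P)
    {T : ℕ} (hT : A.RunsIn T) {H : SimpleGraph V} (hH : H ≤ G) (v : V) :
    A.output v (A.run H T v) = some true ↔ P H := by
  obtain ⟨t, b, hb, hP⟩ := hA H hH v
  obtain ⟨b', hb'⟩ := Option.isSome_iff_exists.1 (hT H hH v)
  have h1 := A.output_run_mono H v (le_max_left t T) hb
  have h2 := A.output_run_mono H v (le_max_right t T) hb'
  obtain rfl : b = b' := Option.some.inj (h1.symm.trans h2)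
  rw [hb', ← hP, Option.some.injEq]

/-- The fooling-set bound for inputs `H x y`, where `x` is visible only to vertices with `ℓ ≤ lo v`
and `y` only to vertices with `hi v = 0`.  For every position `s`, the functions provided by
`hcut` and `hcut'` enumerate the darts over which `lo`, respectively `hi`, jumps across `s`.  If
`P (H x y)` holds exactly for `x = y`, then distinct indices `x` must produce distinct transcripts of
the messages sent over such darts in the execution on `H x x`. -/
theorem card_le_of_fooling (A : BAlgorithm G B) {P : SimpleGraph V → Prop} (hA : A.Verifies P)
    {T : ℕ} (hAT : A.RunsIn T) {I K : Type} [Fintype I] [Fintype K]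
    (H : I → I → SimpleGraph V) (hle : ∀ x y, H x y ≤ G)
    (hpos : ∀ x, P (H x x)) (hneg : ∀ x y, x ≠ y → ¬ P (H x y))
    {lo hi : V → ℕ} {ℓ : ℕ} (hlh : ∀ v, lo v ≤ hi v) (hT : 2 * T ≤ ℓ) (hend : ∃ v, T < hi v)
    (hX : ∀ x y y' v, 0 < hi v → ∀ w, (H x y).Adj v w ↔ (H x y').Adj v w)
    (hY : ∀ x x' y v, lo v < ℓ → ∀ w, (H x y).Adj v w ↔ (H x' y).Adj v w)
    (hcut : ∀ s, ∃ f : K → V × V, ∀ v w, G.Adj v w → lo v < s → s < lo w → ∃ i, f i = (v, w))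
    (hcut' : ∀ s, ∃ f : K → V × V, ∀ v w, G.Adj v w → hi w < s → s < hi v → ∃ i, f i = (v, w)) :
    Fintype.card I ≤ 3 ^ (2 * T * Fintype.card K * B) := by
  classical
  choose f hf using hcut
  choose f' hf' using hcut'
  -- The message in round `t` from `e.2` to `e.1`, in the execution on `H x x`; the default value is
  -- for slots that are not darts of `G`.
  let msg : I → ℕ → V × V → BMessage B := fun x t e =>
    if h : G.Adj e.2 e.1 then A.send e.2 (A.run (H x x) t e.2) ⟨e.1, h⟩ else ⟨[], Nat.zero_le _⟩
  let slot : ℕ → Bool → K → V × V := fun t b k =>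
    if b then f (ℓ - (t + 1)) k else f' (t + 1) k
  let τ : I → Fin T × Bool × K × Fin B → Option Bool := fun x j =>
    (msg x j.1 (slot j.1 j.2.1 j.2.2.1)).bits j.2.2.2
  have hτ : Function.Injective τ := by
    intro x y hxy
    by_contra hne
    have hm : ∀ (t : ℕ) (_ : t < T) (b : Bool) (k : K),
        msg x t (slot t b k) = msg y t (slot t b k) := by
      intro t ht b k
      apply BMessage.bits_injective
      funext i
      exact congrFun hxy (⟨t, ht⟩, b, k, i)
    have hmsg : ∀ t < T, ∀ v w (h : G.Adj v w),
        (lo v < ℓ - (t + 1) ∧ ℓ - (t + 1) < lo w) ∨ (hi w < t + 1 ∧ t + 1 < hi v) →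
        A.send w (A.run (H x x) t w) ⟨v, h.symm⟩ = A.send w (A.run (H y y) t w) ⟨v, h.symm⟩ := by
      intro t ht v w h hc
      have : ∃ b k, slot t b k = (v, w) := by
        rcases hc with ⟨h1, h2⟩ | ⟨h1, h2⟩
        · obtain ⟨k, hk⟩ := hf _ v w h h1 h2
          exact ⟨true, k, hk⟩
        · obtain ⟨k, hk⟩ := hf' _ v w h h1 h2
          exact ⟨false, k, hk⟩
      obtain ⟨b, k, hk⟩ := this
      have := hm t ht b k
      rw [hk] at this
      simpa only [msg, h.symm, dif_pos] using this
    obtain ⟨v, hv⟩ := hend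
    have hrun := ((A.run_hybrid hlh hT (fun v hv => hX x y x v hv) (fun v hv => hY x y y v hv) hmsg
      T le_rfl v).1 hv)
    have := (hA.output_eq hAT (hle x x) v).2 (hpos x)
    rw [← hrun] at this
    exact hneg x y hne ((hA.output_eq hAT (hle x y) v).1 this)
  refine (Fintype.card_le_of_injective τ hτ).trans (le_of_eq ?_)
  simp [Fintype.card_prod]
  ring

end BAlgorithm

/-! ### Two-regular graphs -/

namespace SimpleGraph

variable {V : Type} {H : SimpleGraph V}

theorem mem_edges_of_isCycle_of_twoRegular [Finite V] (hH : ∀ v, (H.neighborSet v).ncard = 2) {a : V}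
    {c : H.Walk a a} (hc : c.IsCycle) {v w : V} (hv : v ∈ c.support) (h : H.Adj v w) :
    s(v, w) ∈ c.edges := by
  classical
  have := Fintype.ofFinite V
  rw [← Walk.adj_toSubgraph_iff_mem_edges]
  exact (hc.adj_toSubgraph_iff_of_isCycles (fun v _ => hH v) (by simpa using hv) w).2 h

/-- In a two-regular graph the vertex set of a cycle is a connected component. -/
theorem mem_support_of_isCycle_of_twoRegular [Finite V] (hH : ∀ v, (H.neighborSet v).ncard = 2)
    {a : V} {c : H.Walk a a} (hc : c.IsCycle) {v : V} (h : H.Reachable a v) : v ∈ c.support := by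
  rw [reachable_iff_reflTransGen] at h
  induction h with
  | refl => exact c.start_mem_support
  | tail _ h ih =>
    exact c.snd_mem_support_of_mem_edges (mem_edges_of_isCycle_of_twoRegular hH hc ih h)

theorem exists_isCycle_of_twoRegular [Finite V] (hH : ∀ v, (H.neighborSet v).ncard = 2) (a : V) :
    ∃ c : H.Walk a a, c.IsCycle := by
  obtain ⟨c, hc, -⟩ := IsCycles.exists_cycle_toSubgraph_verts_eq_connectedComponentSupp
    (c := H.connectedComponentMk a) (fun v _ => hH v) rfl
    (Set.nonempty_of_ncard_ne_zero (by rw [hH a]; decide))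
  exact ⟨c, hc⟩

theorem isHamiltonianCycleGraph_of_twoRegular [Finite V] (hH : ∀ v, (H.neighborSet v).ncard = 2)
    (hconn : H.Connected) : IsHamiltonianCycleGraph H := by
  classical
  have := Fintype.ofFinite V
  obtain ⟨a⟩ := hconn.nonempty
  obtain ⟨c, hc⟩ := exists_isCycle_of_twoRegular hH a
  have hsupp : ∀ v, v ∈ c.support := fun v =>
    mem_support_of_isCycle_of_twoRegular hH hc (hconn.preconnected a v)
  refine ⟨a, c, hc, ?_, ?_⟩
  · have htail : ∀ v, v ∈ c.support.tail := by
      intro v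
      rcases (c.mem_support_iff).1 (hsupp v) with rfl | h
      · exact Walk.end_mem_tail_support hc.not_nil
      · exact h
    have h1 : c.support.tail.toFinset = Finset.univ := by
      ext v; simp [htail v]
    rw [Nat.card_eq_fintype_card, ← Finset.card_univ, ← h1,
      List.toFinset_card_of_nodup hc.support_nodup, List.length_tail, Walk.length_support]
    rfl
  · intro e he
    induction e with
    | h v w => exact mem_edges_of_isCycle_of_twoRegular hH hc (hsupp v) he

theorem _root_.IsHamiltonianCycleGraph.preconnected [Finite V] (h : IsHamiltonianCycleGraph H) :
    H.Preconnected := by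
  classical
  have := Fintype.ofFinite V
  obtain ⟨a, c, hc, hlen, -⟩ := h
  have hham := Walk.isHamiltonianCycle_iff_isCycle_and_length_eq.2
    ⟨hc, by rw [hlen, Nat.card_eq_fintype_card]⟩
  intro v w
  exact (c.takeUntil v (hham.mem_support v)).reachable.symm.trans
    (c.takeUntil w (hham.mem_support w)).reachable

theorem isAcyclic_deleteEdges_of_twoRegular [Finite V] (hH : ∀ v, (H.neighborSet v).ncard = 2)
    (hconn : H.Connected) {v w : V} (h : H.Adj v w) : (H.deleteEdges {s(v, w)}).IsAcyclic := by
  intro a c hc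
  have hle : H.deleteEdges {s(v, w)} ≤ H := deleteEdges_le _
  have hc' : (c.mapLe hle).IsCycle := hc.mapLe hle
  have hv := mem_support_of_isCycle_of_twoRegular hH hc' (hconn.preconnected a v)
  have he := mem_edges_of_isCycle_of_twoRegular hH hc' hv h
  rw [Walk.edges_mapLe_eq_edges] at he
  have := c.edges_subset_edgeSet he
  simp at this

theorem isTree_deleteEdges_of_twoRegular [Finite V] (hH : ∀ v, (H.neighborSet v).ncard = 2)
    (hconn : H.Connected) {v w : V} (h : H.Adj v w) : (H.deleteEdges {s(v, w)}).IsTree := by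
  refine ⟨?_, isAcyclic_deleteEdges_of_twoRegular hH hconn h⟩
  refine hconn.connected_delete_edge_of_not_isBridge fun hb => ?_
  rw [isBridge_iff] at hb
  exact hb (IsCycles.reachable_deleteEdges h (fun v _ => hH v))

theorem neighborSet_deleteEdges_of_ne {u v w : V} (hv : u ≠ v) (hw : u ≠ w) :
    (H.deleteEdges {s(v, w)}).neighborSet u = H.neighborSet u := by
  ext z
  simp only [mem_neighborSet, deleteEdges_adj, Set.mem_singleton_iff, Sym2.eq_iff]
  tauto

theorem ncard_neighborSet_deleteEdges_of_twoRegular [Finite V]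
    (hH : ∀ v, (H.neighborSet v).ncard = 2) {v w : V} (h : H.Adj v w) :
    ((H.deleteEdges {s(v, w)}).neighborSet v).ncard = 1 := by
  have : (H.deleteEdges {s(v, w)}).neighborSet v = H.neighborSet v \ {w} := by
    ext z
    simp only [mem_neighborSet, deleteEdges_adj, Set.mem_singleton_iff, Sym2.eq_iff, Set.mem_sdiff]
    have := h.ne
    grind
  rw [this, Set.ncard_sdiff_singleton_of_mem (show w ∈ H.neighborSet v from h), hH v]

theorem isSimplePathGraph_deleteEdges_of_twoRegular [Finite V]
    (hH : ∀ v, (H.neighborSet v).ncard = 2) (hconn : H.Connected) {v w : V} (h : H.Adj v w) :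
    IsSimplePathGraph (H.deleteEdges {s(v, w)}) := by
  refine ⟨isAcyclic_deleteEdges_of_twoRegular hH hconn h, v, w, h.ne,
    ncard_neighborSet_deleteEdges_of_twoRegular hH h, ?_, fun u hv hw => Or.inr ?_⟩
  · rw [Sym2.eq_swap]
    exact ncard_neighborSet_deleteEdges_of_twoRegular hH h.symm
  · rw [neighborSet_deleteEdges_of_ne hv hw, hH u]

/-- A disconnected two-regular graph keeps a cycle when an edge is removed: the removed edge misses
one of the components. -/
theorem not_isAcyclic_deleteEdges_of_twoRegular [Finite V] (hH : ∀ v, (H.neighborSet v).ncard = 2)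
    (hconn : ¬ H.Preconnected) (v w : V) : ¬ (H.deleteEdges {s(v, w)}).IsAcyclic := by
  intro hac
  have : ∃ u, ¬ H.Reachable u v := by
    by_contra! hall
    exact hconn fun a b => (hall a).trans (hall b).symm
  obtain ⟨u, hu⟩ := this
  obtain ⟨c, hc⟩ := exists_isCycle_of_twoRegular hH u
  classical
  refine hac _ (Walk.IsCycle.toDeleteEdges H {s(v, w)} hc ?_)
  intro e he hev
  rw [Set.mem_singleton_iff] at hev
  subst hev
  exact hu (c.takeUntil v (c.fst_mem_support_of_mem_edges he)).reachable

end SimpleGraph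

/-! ### Chaining strands along a permutation -/

section Strands

variable {S : Type} {len : S → ℕ} {next : S → S}

theorem node_ext {v w : (s : S) × Fin (len s)} (h : v.1 = w.1) (h' : (v.2 : ℕ) = w.2) : v = w := by
  obtain ⟨s, i⟩ := v
  obtain ⟨s', j⟩ := w
  obtain rfl : s = s' := h
  obtain rfl : i = j := Fin.ext h'
  rfl

/-- Each `s : S` stands for a strand, a row of `len s` vertices.  `ChainSucc next v w` says that `w`
comes immediately after `v`, where the last vertex of `s` is followed by the first of `next s`. -/
def ChainSucc (next : S → S) (v w : (s : S) × Fin (len s)) : Prop :=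
  (w.1 = v.1 ∧ (w.2 : ℕ) = v.2 + 1) ∨ ((v.2 : ℕ) + 1 = len v.1 ∧ w.1 = next v.1 ∧ (w.2 : ℕ) = 0)

/-- The undirected graph of all strands, joined end to end as prescribed by `next`. -/
def chainGraph (len : S → ℕ) (next : S → S) : SimpleGraph ((s : S) × Fin (len s)) :=
  SimpleGraph.fromRel (ChainSucc next)

theorem chainGraph_adj {v w : (s : S) × Fin (len s)} :
    (chainGraph len next).Adj v w ↔ v ≠ w ∧ (ChainSucc next v w ∨ ChainSucc next w v) :=
  SimpleGraph.fromRel_adj _ _ _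

theorem ChainSucc.right_unique {v w w' : (s : S) × Fin (len s)} (h : ChainSucc next v w)
    (h' : ChainSucc next v w') : w = w' := by
  have h1 := w.2.isLt
  have h2 := w'.2.isLt
  rcases h with ⟨a, b⟩ | ⟨a, b, c⟩ <;> rcases h' with ⟨a', b'⟩ | ⟨a', b', c'⟩
  · exact node_ext (a.trans a'.symm) (b.trans b'.symm)
  · have := congrArg len a
    omega
  · have := congrArg len a'
    omega
  · exact node_ext (b.trans b'.symm) (c.trans c'.symm)

theorem ChainSucc.left_unique (hinj : Function.Injective next) {v v' w : (s : S) × Fin (len s)}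
    (h : ChainSucc next v w) (h' : ChainSucc next v' w) : v = v' := by
  rcases h with ⟨a, b⟩ | ⟨a, b, c⟩ <;> rcases h' with ⟨a', b'⟩ | ⟨a', b', c'⟩
  · exact node_ext (a.symm.trans a') (by omega)
  · omega
  · omega
  · have := hinj (b.symm.trans b')
    refine node_ext this ?_
    have := congrArg len this
    omega

theorem ChainSucc.exists_right (hlen : ∀ s, 0 < len s) (v : (s : S) × Fin (len s)) :
    ∃ w, ChainSucc next v w := by
  by_cases h : (v.2 : ℕ) + 1 < len v.1
  · exact ⟨⟨v.1, v.2 + 1, h⟩, Or.inl ⟨rfl, rfl⟩⟩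
  · exact ⟨⟨next v.1, 0, hlen _⟩, Or.inr ⟨by have := v.2.isLt; omega, rfl, rfl⟩⟩

theorem ChainSucc.exists_left (hlen : ∀ s, 0 < len s) (hsurj : Function.Surjective next)
    (w : (s : S) × Fin (len s)) : ∃ v, ChainSucc next v w := by
  by_cases h : (w.2 : ℕ) = 0
  · obtain ⟨s, hs⟩ := hsurj w.1
    have := hlen s
    exact ⟨⟨s, len s - 1, by omega⟩, Or.inr ⟨by simp only; omega, hs.symm, h⟩⟩
  · exact ⟨⟨w.1, w.2 - 1, by omega⟩, Or.inl ⟨rfl, by simp only; omega⟩⟩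

theorem ChainSucc.ne (hfix : ∀ s, next s ≠ s) {v w : (s : S) × Fin (len s)}
    (h : ChainSucc next v w) : v ≠ w := by
  rintro rfl
  rcases h with ⟨a, b⟩ | ⟨a, b, c⟩
  · omega
  · exact hfix _ b.symm

/-- No cycle of the chained strands has length two. -/
theorem ChainSucc.not_symm (hfix : ∀ s, next s ≠ s) (hlen : ∀ s, 2 ≤ len s ∨ next (next s) ≠ s)
    {v w : (s : S) × Fin (len s)} (h : ChainSucc next v w) : ¬ ChainSucc next w v := by
  rintro h'
  rcases h with ⟨a, b⟩ | ⟨a, b, c⟩ <;> rcases h' with ⟨a', b'⟩ | ⟨a', b', c'⟩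
  · omega
  · exact hfix _ (b'.symm.trans a.symm)
  · exact hfix _ (b.symm.trans a'.symm)
  · rcases hlen v.1 with h | h
    · omega
    · exact h (by rw [← b, ← b'])

theorem chainGraph_twoRegular [Finite S] (hinj : Function.Injective next) (hpos : ∀ s, 0 < len s)
    (hfix : ∀ s, next s ≠ s) (hlen : ∀ s, 2 ≤ len s ∨ next (next s) ≠ s)
    (v : (s : S) × Fin (len s)) : ((chainGraph len next).neighborSet v).ncard = 2 := by
  obtain ⟨w, hw⟩ := ChainSucc.exists_right (next := next) hpos v
  obtain ⟨u, hu⟩ := ChainSucc.exists_left hpos (Finite.surjective_of_injective hinj) v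
  have huw : u ≠ w := by
    rintro rfl
    exact hw.not_symm hfix hlen hu
  have : (chainGraph len next).neighborSet v = {u, w} := by
    ext z
    rw [SimpleGraph.mem_neighborSet, chainGraph_adj, Set.mem_insert_iff, Set.mem_singleton_iff]
    constructor
    · rintro ⟨-, h | h⟩
      · exact Or.inr (h.right_unique hw)
      · exact Or.inl (h.left_unique hinj hu)
    · rintro (rfl | rfl)
      · exact ⟨(hu.ne hfix).symm, Or.inr hu⟩
      · exact ⟨hw.ne hfix, Or.inl hw⟩
  rw [this, Set.ncard_pair huw]

theorem ChainSucc.reachable {v w : (s : S) × Fin (len s)} (h : ChainSucc next v w) :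
    (chainGraph len next).Reachable v w := by
  by_cases hvw : v = w
  · rw [hvw]
  · exact SimpleGraph.Adj.reachable (chainGraph_adj.2 ⟨hvw, Or.inl h⟩)

theorem chainGraph_reachable_strand (s : S) (h0 : 0 < len s) (i : ℕ) (hi : i < len s) :
    (chainGraph len next).Reachable ⟨s, 0, h0⟩ ⟨s, i, hi⟩ := by
  induction i with
  | zero => rfl
  | succ i ih =>
    exact (ih (by omega)).trans (ChainSucc.reachable (Or.inl ⟨rfl, rfl⟩))

theorem chainGraph_connected (hpos : ∀ s, 0 < len s) (s₀ : S)
    (hgen : ∀ C : S → Prop, C s₀ → (∀ s, C s → C (next s)) → ∀ s, C s) :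
    (chainGraph len next).Connected := by
  have h1 : ∀ s, (chainGraph len next).Reachable ⟨s₀, 0, hpos _⟩ ⟨s, 0, hpos _⟩ := by
    refine hgen _ (by rfl) fun s hs => (hs.trans (chainGraph_reachable_strand s _ (len s - 1)
      (by have := hpos s; omega))).trans (ChainSucc.reachable (Or.inr ⟨?_, rfl, rfl⟩))
    have := hpos s
    simp only
    omega
  have h2 : ∀ v, (chainGraph len next).Reachable ⟨s₀, 0, hpos _⟩ v := fun v =>
    (h1 v.1).trans (chainGraph_reachable_strand v.1 _ v.2 v.2.isLt)
  have : Nonempty ((s : S) × Fin (len s)) := ⟨⟨s₀, 0, hpos _⟩⟩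
  exact ⟨fun v w => (h2 v).symm.trans (h2 w)⟩

/-- Two strands that follow each other in both directions close up to a separate cycle. -/
theorem chainGraph_not_preconnected (hinj : Function.Injective next) (hpos : ∀ s, 0 < len s)
    {s s' : S} (hs : next (next s) = s) (h1 : s' ≠ s) (h2 : s' ≠ next s) :
    ¬ (chainGraph len next).Preconnected := by
  intro hc
  have hstep : ∀ r, (next r = s ∨ next r = next s) ↔ (r = s ∨ r = next s) := by
    intro r
    rw [hinj.eq_iff]
    constructor
    · rintro (h | h)
      · exact Or.inr (hinj (h.trans hs.symm))
      · exact Or.inl h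
    · rintro (rfl | rfl)
      · exact Or.inr rfl
      · exact Or.inl hs
  have hsucc : ∀ v w : (s : S) × Fin (len s), ChainSucc next v w →
      ((v.1 = s ∨ v.1 = next s) ↔ (w.1 = s ∨ w.1 = next s)) := by
    rintro v w (⟨a, b⟩ | ⟨a, b, c⟩)
    · rw [a]
    · rw [b, hstep]
  have hreach := hc ⟨s, 0, hpos _⟩ ⟨s', 0, hpos _⟩
  rw [SimpleGraph.reachable_iff_reflTransGen] at hreach
  have : ∀ v, Relation.ReflTransGen (chainGraph len next).Adj ⟨s, 0, hpos _⟩ v →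
      v.1 = s ∨ v.1 = next s := by
    intro v hv
    induction hv with
    | refl => exact Or.inl rfl
    | tail _ h ih =>
      rcases (chainGraph_adj.1 h).2 with h | h
      · exact (hsucc _ _ h).1 ih
      · exact (hsucc _ _ h).2 ih
  rcases this _ hreach with h | h
  · exact h1 h
  · exact h2 h

end Strands

/-! ### The network -/

/-- The strands of the network.  Each bit of the inputs owns four strands, which run through all
positions `0, …, d ^ p - 1`: the ones with `west = true` are traversed downwards, the others upwards.
The levels form a complete `d`-ary tree, and `line` is a path that starts near position `d ^ p - 1` and
ends at the root of the tree. -/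
inductive Strand (p Γ : ℕ) : Type
  | line : Strand p Γ
  | level (k : Fin (p + 1)) : Strand p Γ
  | bit (i : Fin Γ) (c west : Bool) : Strand p Γ

namespace Strand

variable {p Γ : ℕ}

def equivSum (p Γ : ℕ) : Strand p Γ ≃ Unit ⊕ Fin (p + 1) ⊕ (Fin Γ × Bool × Bool) where
  toFun
    | line => .inl ()
    | level k => .inr (.inl k)
    | bit i c b => .inr (.inr (i, c, b))
  invFun
    | .inl _ => line
    | .inr (.inl k) => level k
    | .inr (.inr (i, c, b)) => bit i c b
  left_inv := by rintro (_ | _ | _) <;> rfl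
  right_inv := by rintro (_ | _ | _) <;> rfl

instance : Fintype (Strand p Γ) := Fintype.ofEquiv _ (equivSum p Γ).symm

/-- The number of vertices on a strand. -/
def len (d : ℕ) : Strand p Γ → ℕ
  | line => 3 * p + 2
  | level k => d ^ (k : ℕ)
  | bit _ _ _ => d ^ p

/-- The first strand of the `i`-th bit, or `line` if there are no more bits. -/
def enter (i : ℕ) : Strand p Γ := if h : i < Γ then bit ⟨i, h⟩ false true else line

/-- The `k`-th level of the tree, or the first strand of the bits if there are no more levels. -/
def climb (k : ℕ) : Strand p Γ := if h : k < p + 1 then level ⟨k, h⟩ else enter 0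

/-- The order in which the input `(x, y)` chains the strands.  At the end of low positions `y i` says
whether the two pairs of strands of bit `i` are crossed, at the end of high positions `x i` does. -/
def next (x y : Fin Γ → Bool) : Strand p Γ → Strand p Γ
  | line => climb 0
  | level k => climb (k + 1)
  | bit i c true => bit i (c ^^ y i) false
  | bit i c false => if (c ^^ x i) then enter (i + 1) else bit i true true

/-- The left end of the interval of positions occupied by a vertex: a tree vertex occupies the positions
of the leaves below it, any other vertex a single position. -/
def lo (d : ℕ) : Strand p Γ → ℕ → ℕ
  | line, _ => d ^ p - 1
  | level k, t => t * d ^ (p - k)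
  | bit _ _ true, t => d ^ p - 1 - t
  | bit _ _ false, t => t

/-- The right end of the interval of positions occupied by a vertex. -/
def hi (d : ℕ) : Strand p Γ → ℕ → ℕ
  | line, _ => d ^ p - 1
  | level k, t => (t + 1) * d ^ (p - k) - 1
  | bit _ _ true, t => d ^ p - 1 - t
  | bit _ _ false, t => t

/-- The ends of strands that occupy the last position. -/
def East (d : ℕ) : Strand p Γ → ℕ → Prop
  | line, t => t = 0
  | level k, t => (k : ℕ) = p ∧ t + 1 = d ^ p
  | bit _ _ true, t => t = 0
  | bit _ _ false, t => t + 1 = d ^ p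

/-- The ends of strands that occupy position `0` and belong to bits. -/
def West (d : ℕ) : Strand p Γ → ℕ → Prop
  | bit _ _ true, t => t + 1 = d ^ p
  | bit _ _ false, t => t = 0
  | _, _ => False

/-- The edges of the network: those along strands, all those inside the two groups of strand ends, the
tree edges, and a few edges joining consecutive strands.  The edge `bypass` brings the far part of
`line` within distance `p + 1` of the root. -/
inductive Link (d : ℕ) : Strand p Γ → ℕ → Strand p Γ → ℕ → Prop
  | step {s t t'} (h : t' = t + 1) : Link d s t s t'
  | east {s t s' t'} (h : East d s t) (h' : East d s' t') : Link d s t s' t'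
  | west {s t s' t'} (h : West d s t) (h' : West d s' t') : Link d s t s' t'
  | summit {k : Fin (p + 1)} {t t'} (hk : (k : ℕ) = 0) (h : t + 1 = 3 * p + 2) (h' : t' = 0) :
      Link d line t (level k) t'
  | wrap {k k' : Fin (p + 1)} {t t'} (hk : (k' : ℕ) = k + 1) (h : t + 1 = d ^ (k : ℕ)) (h' : t' = 0) :
      Link d (level k) t (level k') t'
  | child {k k' : Fin (p + 1)} {t t'} (hk : (k' : ℕ) = k + 1) (h : t' / d = t) :
      Link d (level k) t (level k') t'
  | leaf {k : Fin (p + 1)} {t i c b t'} (hk : (k : ℕ) = p) (h : lo d (bit i c b : Strand p Γ) t' = t) :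
      Link d (level k) t (bit i c b) t'
  | bypass {k : Fin (p + 1)} {t t'} (hk : (k : ℕ) = 0) (h : t = 0) (h' : t' = p) :
      Link d (level k) t line t'

theorem len_pos {d : ℕ} (hd : 2 ≤ d) (s : Strand p Γ) : 0 < len d s := by
  cases s <;> simp only [len] <;> positivity

theorem next_injective (x y : Fin Γ → Bool) : Function.Injective (next (p := p) x y) := by
  rintro (_ | k | ⟨i, (_ | _), (_ | _)⟩) (_ | k' | ⟨i', (_ | _), (_ | _)⟩) h <;>
    first
    | grind [next, climb, enter]
    | simp only [next, bit.injEq] at h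
      obtain ⟨rfl, h, -⟩ := h
      cases hy : y i <;> simp_all

theorem next_ne (x y : Fin Γ → Bool) (s : Strand p Γ) : next x y s ≠ s := by
  rcases s with _ | k | ⟨i, c, (_ | _)⟩ <;> grind [next, climb, enter]

theorem two_le_len_or {d : ℕ} (hp : 1 ≤ p) (hd : 2 ≤ d) (x y : Fin Γ → Bool) (s : Strand p Γ) :
    2 ≤ len d s ∨ next x y (next x y s) ≠ s := by
  rcases s with _ | k | ⟨i, c, b⟩
  · left; simp only [len]; omega
  · by_cases hk : (k : ℕ) = 0
    · right
      simp only [next, climb, hk]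
      grind [next, climb, enter]
    · left
      exact hd.trans (Nat.le_self_pow hk d)
  · left
    exact hd.trans (Nat.le_self_pow (by omega) d)

/-- On equal inputs a single cycle goes through all strands. -/
theorem next_self_induction (x : Fin Γ → Bool) (C : Strand p Γ → Prop) (h0 : C line)
    (hs : ∀ s, C s → C (next x x s)) (s : Strand p Γ) : C s := by
  have hclimb : ∀ k ≤ p + 1, C (climb k) := by
    intro k
    induction k with
    | zero => exact fun _ => hs _ h0
    | succ k ih =>
      intro hk
      have h := hs _ (ih (by omega))
      rw [climb, dif_pos (by omega)] at h
      exact h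
  have hbit : ∀ i (h : i < Γ), C (enter i) → C (enter (i + 1)) ∧ ∀ c b, C (bit ⟨i, h⟩ c b) := by
    intro i h hi
    rw [enter, dif_pos h] at hi
    have h1 := hs _ hi
    have h2 := hs _ h1
    simp only [next, Bool.false_xor, Bool.xor_self, Bool.false_eq_true, if_false] at h1 h2
    have h3 := hs _ h2
    have h4 := hs _ h3
    simp only [next, Bool.xor_assoc, Bool.xor_self, Bool.xor_false, if_true] at h3 h4
    refine ⟨h4, fun c b => ?_⟩
    cases hx : x ⟨i, h⟩ <;> simp only [hx, Bool.true_xor, Bool.not_true, Bool.not_false] at h1 h3 <;>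
      cases c <;> cases b <;> assumption
  have henter : ∀ i ≤ Γ, C (enter i) := by
    intro i
    induction i with
    | zero =>
      intro _
      have := hclimb (p + 1) le_rfl
      rwa [climb, dif_neg (by omega)] at this
    | succ i ih => exact fun hi => (hbit i hi (ih (by omega))).1
  rcases s with _ | k | ⟨i, c, b⟩
  · exact h0
  · have := hclimb k (by omega)
    rwa [climb, dif_pos k.isLt] at this
  · exact (hbit i i.isLt (henter i (by omega))).2 c b

/-- Where the inputs differ, two strands of that bit close up to a cycle of their own. -/
theorem next_next_of_ne {x y : Fin Γ → Bool} {i : Fin Γ} (h : x i ≠ y i) :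
    next x y (next x y (bit i true true : Strand p Γ)) = bit i true true := by
  simp only [next]
  rw [if_neg]
  cases hx : x i <;> cases hy : y i <;> simp_all

theorem lo_le_hi {d : ℕ} (hd : 2 ≤ d) (s : Strand p Γ) (t : ℕ) : lo d s t ≤ hi d s t := by
  rcases s with _ | k | ⟨i, c, (_ | _)⟩ <;> simp only [lo, hi, le_refl]
  have : 0 < d ^ (p - k) := by positivity
  rw [add_one_mul]
  omega

theorem East.lo_eq {d : ℕ} {s : Strand p Γ} {t : ℕ} (h : East d s t) : lo d s t = d ^ p - 1 := by
  rcases s with _ | k | ⟨i, c, (_ | _)⟩ <;> simp only [lo, East] at *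
  · rw [h.1, Nat.sub_self, pow_zero]; omega
  · omega
  · omega

theorem East.hi_eq {d : ℕ} {s : Strand p Γ} {t : ℕ} (h : East d s t) : hi d s t = d ^ p - 1 := by
  rcases s with _ | k | ⟨i, c, (_ | _)⟩ <;> simp only [hi, East] at *
  · rw [h.1, Nat.sub_self, pow_zero]; omega
  · omega
  · omega

theorem West.lo_eq {d : ℕ} {s : Strand p Γ} {t : ℕ} (h : West d s t) : lo d s t = 0 := by
  rcases s with _ | k | ⟨i, c, (_ | _)⟩ <;> simp only [lo, West] at * <;> omega

theorem West.hi_eq {d : ℕ} {s : Strand p Γ} {t : ℕ} (h : West d s t) : hi d s t = 0 := by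
  rcases s with _ | k | ⟨i, c, (_ | _)⟩ <;> simp only [hi, West] at * <;> omega

end Strand

section Network

open Strand

/-- The vertices of the network. -/
abbrev Net (p Γ d : ℕ) : Type := (s : Strand p Γ) × Fin (len d s)

/-- The network. -/
def netGraph (p Γ d : ℕ) : SimpleGraph (Net p Γ d) :=
  SimpleGraph.fromRel fun v w => Link d v.1 v.2 w.1 w.2

/-- The input subgraph that encodes the pair `(x, y)`. -/
def inputGraph (p Γ d : ℕ) (x y : Fin Γ → Bool) : SimpleGraph (Net p Γ d) :=
  chainGraph (len d) (next x y)

variable {p Γ d : ℕ}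

theorem netGraph_adj {v w : Net p Γ d} : (netGraph p Γ d).Adj v w ↔
    v ≠ w ∧ (Link d v.1 v.2 w.1 w.2 ∨ Link d w.1 w.2 v.1 v.2) :=
  SimpleGraph.fromRel_adj _ _ _

theorem east_enter (i : ℕ) : East d (enter i : Strand p Γ) 0 := by
  unfold enter
  split <;> simp [East]

theorem ChainSucc.link {x y : Fin Γ → Bool} {v w : Net p Γ d} (h : ChainSucc (next x y) v w) :
    Link d v.1 v.2 w.1 w.2 := by
  obtain ⟨s, t, ht⟩ := v
  obtain ⟨s', t', ht'⟩ := w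
  rcases h with ⟨a, b⟩ | ⟨a, b, c⟩
  · obtain rfl : s' = s := a
    exact .step b
  · simp only at a b c ⊢
    subst b c
    rcases s with _ | k | ⟨i, c, (_ | _)⟩
    · simp only [next, climb, dif_pos (Nat.succ_pos p)]
      exact .summit rfl a rfl
    · simp only [next, climb]
      split
      · exact .wrap rfl a rfl
      · have hk : (k : ℕ) = p := by omega
        exact .east ⟨hk, by simpa [len, hk] using a⟩ (east_enter 0)
    · simp only [next]
      refine .east a ?_
      split
      · exact east_enter _
      · rfl
    · exact .west a rfl

theorem inputGraph_le (x y : Fin Γ → Bool) : inputGraph p Γ d x y ≤ netGraph p Γ d := by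
  intro v w h
  obtain ⟨hne, h | h⟩ := chainGraph_adj.1 h
  · exact netGraph_adj.2 ⟨hne, Or.inl h.link⟩
  · exact netGraph_adj.2 ⟨hne, Or.inr h.link⟩

theorem inputGraph_twoRegular (hp : 1 ≤ p) (hd : 2 ≤ d) (x y : Fin Γ → Bool) (v : Net p Γ d) :
    ((inputGraph p Γ d x y).neighborSet v).ncard = 2 :=
  chainGraph_twoRegular (next_injective x y) (len_pos hd) (next_ne x y) (two_le_len_or hp hd x y) v

theorem inputGraph_self_connected (hd : 2 ≤ d) (x : Fin Γ → Bool) :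
    (inputGraph p Γ d x x).Connected :=
  chainGraph_connected (len_pos hd) line (next_self_induction x)

theorem inputGraph_not_preconnected (hd : 2 ≤ d) {x y : Fin Γ → Bool} (h : x ≠ y) :
    ¬ (inputGraph p Γ d x y).Preconnected := by
  obtain ⟨i, hi⟩ := Function.ne_iff.1 h
  exact chainGraph_not_preconnected (s' := line) (next_injective x y) (len_pos hd)
    (next_next_of_ne hi) (by simp) (by simp [next])

theorem ChainSucc.change_right {x y : Fin Γ → Bool} (y' : Fin Γ → Bool) {v w : Net p Γ d}
    (h : ChainSucc (next x y) v w) (hvw : 0 < hi d v.1 v.2 ∨ 0 < hi d w.1 w.2) :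
    ChainSucc (next x y') v w := by
  obtain ⟨s, t, ht⟩ := v
  obtain ⟨s', t', ht'⟩ := w
  rcases h with h | ⟨a, b, c⟩
  · exact Or.inl h
  · simp only at a b c hvw
    subst b c
    rcases s with _ | k | ⟨i, c, (_ | _)⟩
    · exact Or.inr ⟨a, rfl, rfl⟩
    · exact Or.inr ⟨a, rfl, rfl⟩
    · exact Or.inr ⟨a, rfl, rfl⟩
    · simp only [next, hi, len] at hvw a
      omega

theorem ChainSucc.change_left {x y : Fin Γ → Bool} (x' : Fin Γ → Bool) {v w : Net p Γ d}
    (h : ChainSucc (next x y) v w) (hvw : lo d v.1 v.2 < d ^ p - 1 ∨ lo d w.1 w.2 < d ^ p - 1) :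
    ChainSucc (next x' y) v w := by
  obtain ⟨s, t, ht⟩ := v
  obtain ⟨s', t', ht'⟩ := w
  rcases h with h | ⟨a, b, c⟩
  · exact Or.inl h
  · simp only at a b c hvw
    subst b c
    rcases s with _ | k | ⟨i, c, (_ | _)⟩
    · exact Or.inr ⟨a, rfl, rfl⟩
    · exact Or.inr ⟨a, rfl, rfl⟩
    · have h1 : East d (bit i c false : Strand p Γ) t := a
      have h2 : East d (next x y (bit i c false : Strand p Γ)) 0 := by
        simp only [next]
        split
        · exact east_enter _
        · rfl
      rw [h1.lo_eq, h2.lo_eq] at hvw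
      omega
    · exact Or.inr ⟨a, rfl, rfl⟩

theorem inputGraph_adj_change_right (x y y' : Fin Γ → Bool) (v : Net p Γ d)
    (hv : 0 < hi d v.1 v.2) (w : Net p Γ d) :
    (inputGraph p Γ d x y).Adj v w ↔ (inputGraph p Γ d x y').Adj v w := by
  unfold inputGraph
  rw [chainGraph_adj, chainGraph_adj]
  exact and_congr_right fun _ => or_congr
    ⟨fun h => h.change_right y' (.inl hv), fun h => h.change_right y (.inl hv)⟩
    ⟨fun h => h.change_right y' (.inr hv), fun h => h.change_right y (.inr hv)⟩

theorem inputGraph_adj_change_left (x x' y : Fin Γ → Bool) (v : Net p Γ d)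
    (hv : lo d v.1 v.2 < d ^ p - 1) (w : Net p Γ d) :
    (inputGraph p Γ d x y).Adj v w ↔ (inputGraph p Γ d x' y).Adj v w := by
  unfold inputGraph
  rw [chainGraph_adj, chainGraph_adj]
  exact and_congr_right fun _ => or_congr
    ⟨fun h => h.change_left x' (.inl hv), fun h => h.change_left x (.inl hv)⟩
    ⟨fun h => h.change_left x' (.inr hv), fun h => h.change_left x (.inr hv)⟩

/-! ### Diameter -/

/-- The height of a vertex above the middle of the path `line`, in the sense that the root has height
`p + 1` and the strands of the bits have height `2 p + 2`. -/
def Strand.height : Strand p Γ → ℕ → ℤ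
  | line, t => |(t : ℤ) - (2 * p + 1)|
  | level k, _ => p + 1 + k
  | bit _ _ _, _ => 2 * p + 2

/-- An upper bound for the distance of a vertex to the root. -/
def Strand.depth : Strand p Γ → ℕ → ℕ
  | line, t => if 2 * p + 1 ≤ t then 3 * p + 2 - t else if p ≤ t then t - p + 1 else p - t + 1
  | level k, _ => k
  | bit _ _ _, _ => p + 1

theorem Strand.East.height_mem {s : Strand p Γ} {t : ℕ} (h : East d s t) :
    2 * (p : ℤ) + 1 ≤ height s t ∧ height s t ≤ 2 * p + 2 := by
  rcases s with _ | k | ⟨i, c, b⟩ <;> simp only [East] at h <;> simp only [height]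
  · subst h
    rw [abs_of_nonpos (by push_cast; omega)]
    push_cast
    omega
  · omega
  · omega

theorem Strand.West.height_eq {s : Strand p Γ} {t : ℕ} (h : West d s t) :
    height s t = 2 * p + 2 := by
  rcases s with _ | k | ⟨i, c, b⟩ <;> simp_all [height, West]

theorem Strand.Link.height_le {s s' : Strand p Γ} {t t' : ℕ} (h : Link d s t s' t') :
    |height s t - height s' t'| ≤ 1 := by
  cases h with
  | step h =>
    subst h
    rcases s with _ | k | ⟨i, c, b⟩ <;> simp only [height, sub_self, abs_zero, zero_le_one]
    refine (abs_abs_sub_abs_le_abs_sub _ _).trans ?_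
    push_cast
    rw [abs_le]
    omega
  | east h h' =>
    have := h.height_mem
    have := h'.height_mem
    rw [abs_le]
    omega
  | west h h' => rw [h.height_eq, h'.height_eq]; simp
  | summit hk h h' =>
    simp only [height, hk]
    rw [abs_of_nonneg (by omega : (0 : ℤ) ≤ (t : ℤ) - (2 * p + 1)), abs_le]
    push_cast
    omega
  | wrap hk h h' =>
    simp only [height, hk]
    rw [abs_le]
    push_cast
    omega
  | child hk h =>
    simp only [height, hk]
    rw [abs_le]
    push_cast
    omega
  | leaf hk h =>
    simp only [height, hk]
    rw [abs_le]
    omega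
  | bypass hk h h' =>
    simp only [height, hk, h']
    rw [abs_of_nonpos (by omega : (p : ℤ) - (2 * p + 1) ≤ 0), abs_le]
    push_cast
    omega

theorem height_sub_le_dist (hconn : (netGraph p Γ d).Connected) (v w : Net p Γ d) :
    |height v.1 v.2 - height w.1 w.2| ≤ (netGraph p Γ d).dist v w := by
  obtain ⟨q, hq⟩ := hconn.exists_walk_length_eq_dist v w
  rw [← hq]
  clear hq
  induction q with
  | nil => simp
  | @cons u v w h q ih =>
    have h1 : |height u.1 u.2 - height v.1 v.2| ≤ 1 := by
      rcases (netGraph_adj.1 h).2 with h | h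
      · exact h.height_le
      · rw [abs_sub_comm]
        exact h.height_le
    have := abs_sub_le (height u.1 u.2) (height v.1 v.2) (height w.1 w.2)
    rw [SimpleGraph.Walk.length_cons]
    push_cast
    omega

/-- Every vertex other than the root has a neighbour that is closer to the root. -/
theorem exists_adj_depth_lt (hd : 2 ≤ d) (v : Net p Γ d) (hv : 0 < depth v.1 v.2) :
    ∃ w, (netGraph p Γ d).Adj v w ∧ depth w.1 w.2 < depth v.1 v.2 := by
  suffices ∃ w : Net p Γ d, (Link d v.1 v.2 w.1 w.2 ∨ Link d w.1 w.2 v.1 v.2) ∧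
      depth w.1 w.2 < depth v.1 v.2 by
    obtain ⟨w, h, hlt⟩ := this
    refine ⟨w, netGraph_adj.2 ⟨?_, h⟩, hlt⟩
    rintro rfl
    exact lt_irrefl _ hlt
  obtain ⟨s, t, ht⟩ := v
  simp only at hv ⊢
  rcases s with _ | k | ⟨i, c, b⟩
  · simp only [len] at ht
    by_cases h1 : 2 * p + 1 ≤ t
    · by_cases h2 : t + 1 = 3 * p + 2
      · refine ⟨⟨level 0, 0, by simp [len]⟩, Or.inl (.summit rfl h2 rfl), ?_⟩
        simp only [depth, Fin.val_zero]
        split_ifs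
        omega
      · refine ⟨⟨line, t + 1, by simp only [len]; omega⟩, Or.inl (.step rfl), ?_⟩
        simp only [depth]
        split_ifs <;> omega
    · rcases lt_trichotomy t p with h2 | h2 | h2
      · refine ⟨⟨line, t + 1, by simp only [len]; omega⟩, Or.inl (.step rfl), ?_⟩
        simp only [depth]
        split_ifs <;> omega
      · refine ⟨⟨level 0, 0, by simp [len]⟩, Or.inr (.bypass rfl rfl h2), ?_⟩
        simp only [depth, Fin.val_zero]
        split_ifs <;> omega
      · refine ⟨⟨line, t - 1, by simp only [len]; omega⟩,
          Or.inr (.step (by simp only; omega)), ?_⟩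
        simp only [depth]
        split_ifs <;> omega
  · simp only [depth] at hv
    simp only [len] at ht
    have hk : (k : ℕ) - 1 + 1 = k := by omega
    refine ⟨⟨level ⟨k - 1, by omega⟩, t / d, ?_⟩, Or.inr (.child hk.symm rfl), ?_⟩
    · simp only [len]
      rw [Nat.div_lt_iff_lt_mul (by omega), ← pow_succ, hk]
      exact ht
    · simp only [depth]
      omega
  · simp only [len] at ht
    refine ⟨⟨level (Fin.last p), lo d (bit i c b : Strand p Γ) t, ?_⟩,
      Or.inr (.leaf rfl rfl), ?_⟩
    · cases b <;> simp only [lo, len, Fin.val_last] <;> omega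
    · simp [depth]

theorem exists_walk_root (hd : 2 ≤ d) (v : Net p Γ d) :
    ∃ q : (netGraph p Γ d).Walk v ⟨level 0, 0, by simp [len]⟩, q.length ≤ depth v.1 v.2 := by
  induction hn : depth v.1 v.2 using Nat.strong_induction_on generalizing v with
  | _ n ih =>
    rcases Nat.eq_zero_or_pos n with h0 | h0
    · have : v = ⟨level 0, 0, by simp [len]⟩ := by
        obtain ⟨s, t, ht⟩ := v
        rcases s with _ | k | ⟨i, c, b⟩
        · simp only [depth, len] at hn ht
          split_ifs at hn <;> omega
        · have hk : k = 0 := Fin.ext (show (k : ℕ) = 0 by simp only [depth] at hn; omega)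
          subst hk
          refine node_ext rfl ?_
          simp only [len, Fin.val_zero, pow_zero] at ht ⊢
          omega
        · simp only [depth] at hn
          omega
      subst this
      exact ⟨.nil, by simp⟩
    · obtain ⟨w, hw, hlt⟩ := exists_adj_depth_lt hd v (by omega)
      obtain ⟨q, hq⟩ := ih _ (hn ▸ hlt) w rfl
      exact ⟨.cons hw q, by rw [SimpleGraph.Walk.length_cons]; omega⟩

theorem netGraph_connected (hd : 2 ≤ d) : (netGraph p Γ d).Connected := by
  have : Nonempty (Net p Γ d) := ⟨⟨level 0, 0, by simp [len]⟩⟩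
  refine ⟨fun v w => ?_⟩
  obtain ⟨q, -⟩ := exists_walk_root hd v
  obtain ⟨q', -⟩ := exists_walk_root hd w
  exact q.reachable.trans q'.reachable.symm

theorem Strand.depth_le {s : Strand p Γ} {t : ℕ} (ht : t < len d s) : depth s t ≤ p + 1 := by
  rcases s with _ | k | ⟨i, c, b⟩ <;> simp only [depth, len] at *
  · split_ifs <;> omega
  · omega
  · omega

theorem netGraph_diam (hd : 2 ≤ d) (hΓ : 0 < Γ) : (netGraph p Γ d).diam = 2 * p + 2 := by
  have hconn := netGraph_connected (p := p) (Γ := Γ) hd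
  have : Nonempty (Net p Γ d) := hconn.nonempty
  apply le_antisymm
  · obtain ⟨v, w, h⟩ := (netGraph p Γ d).exists_dist_eq_diam
    obtain ⟨q, hq⟩ := exists_walk_root hd v
    obtain ⟨q', hq'⟩ := exists_walk_root hd w
    have h1 := SimpleGraph.dist_le (q.append q'.reverse)
    rw [SimpleGraph.Walk.length_append, SimpleGraph.Walk.length_reverse] at h1
    have := depth_le v.2.isLt
    have := depth_le w.2.isLt
    omega
  · have h1 := height_sub_le_dist hconn ⟨line, 2 * p + 1, by simp only [len]; omega⟩
      ⟨bit ⟨0, hΓ⟩ true true, 0, len_pos hd _⟩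
    have h2 : (netGraph p Γ d).dist _ _ ≤ _ := SimpleGraph.dist_le_diam
      (SimpleGraph.connected_iff_ediam_ne_top.1 hconn)
      (u := ⟨line, 2 * p + 1, by simp only [len]; omega⟩)
      (v := ⟨bit ⟨0, hΓ⟩ true true, 0, len_pos hd _⟩)
    have h3 := (neg_le_abs _).trans h1
    simp only [height] at h3
    push_cast at h3
    simp only [sub_self, abs_zero] at h3
    omega

/-! ### Few edges jump over a position -/

/-- The vertex number `t` of the strand `s` (a default vertex if there is none). -/
def Strand.vertex (d : ℕ) (s : Strand p Γ) (t : ℕ) : Net p Γ d :=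
  if h : t < len d s then ⟨s, t, h⟩ else ⟨line, 0, by simp [len]⟩

theorem vertex_self (v : Net p Γ d) : vertex d v.1 v.2 = v := by
  rw [vertex, dif_pos v.2.isLt]

/-- The darts over which `lo` can jump from below `s` to above `s`: on level `k` they are incident to
the vertex above position `s`, except for the one that leads back from the next level. -/
def slotLo (s : ℕ) : Fin (p + 1) × (Fin d ⊕ Fin 4) → Net p Γ d × Net p Γ d
  | (k, .inl r) => (vertex d (level k) (s / d ^ (p - k)),
      vertex d (climb (k + 1)) (s / d ^ (p - k) * d + r))
  | (k, .inr 0) => (vertex d (level k) (s / d ^ (p - k)), vertex d (level k) (s / d ^ (p - k) + 1))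
  | (k, .inr 1) => (vertex d (climb (k + 1)) 0, vertex d (level k) (d ^ (k : ℕ) - 1))
  | (_, .inr 2) => (vertex d (level 0) 0, vertex d line (3 * p + 1))
  | (_, .inr 3) => (vertex d (level 0) 0, vertex d line p)

/-- The darts over which `hi` can jump from above `s` to below `s`. -/
def slotHi (s : ℕ) : Fin (p + 1) × (Fin d ⊕ Fin 4) → Net p Γ d × Net p Γ d
  | (k, .inl r) => (vertex d (level k) (s / d ^ (p - k)),
      vertex d (climb (k + 1)) (s / d ^ (p - k) * d + r))
  | (k, .inr 0) => (vertex d (level k) (s / d ^ (p - k)), vertex d (level k) (s / d ^ (p - k) - 1))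
  | (k, .inr _) => (vertex d (level k) (d ^ (k : ℕ) - 1), vertex d (climb (k + 1)) 0)

theorem pow_sub_eq {k k' : Fin (p + 1)} (hk : (k' : ℕ) = k + 1) :
    d ^ (p - (k : ℕ)) = d * d ^ (p - (k' : ℕ)) := by
  rw [← pow_succ']
  congr 1
  omega

theorem climb_eq {k k' : Fin (p + 1)} (hk : (k' : ℕ) = k + 1) :
    (climb (k + 1) : Strand p Γ) = level k' := by
  rw [climb, dif_pos (by omega)]
  congr 1
  exact Fin.ext hk.symm

theorem lo_child {k k' : Fin (p + 1)} (hk : (k' : ℕ) = k + 1) {t t' : ℕ} (h : t' / d = t) :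
    lo d (level k : Strand p Γ) t ≤ lo d (level k' : Strand p Γ) t' := by
  simp only [lo]
  rw [pow_sub_eq hk, ← mul_assoc]
  exact Nat.mul_le_mul_right _ (h ▸ Nat.div_mul_le_self _ _)

theorem hi_child (hd : 2 ≤ d) {k k' : Fin (p + 1)} (hk : (k' : ℕ) = k + 1) {t t' : ℕ}
    (h : t' / d = t) : hi d (level k' : Strand p Γ) t' ≤ hi d (level k : Strand p Γ) t := by
  simp only [hi]
  rw [pow_sub_eq hk, ← mul_assoc]
  refine Nat.sub_le_sub_right (Nat.mul_le_mul_right _ ?_) 1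
  have := Nat.lt_div_mul_add (a := t') (b := d) (by omega)
  subst h
  rw [add_one_mul]
  omega

/-- A position strictly inside the interval of a tree vertex determines this vertex. -/
theorem div_pow_eq (hd : 2 ≤ d) {k : Fin (p + 1)} {s t : ℕ} (h1 : lo d (level k : Strand p Γ) t ≤ s)
    (h2 : s ≤ hi d (level k : Strand p Γ) t) : s / d ^ (p - (k : ℕ)) = t := by
  simp only [lo, hi] at h1 h2
  have : 0 < d ^ (p - (k : ℕ)) := by positivity
  refine Nat.div_eq_of_lt_le h1 ?_
  rw [add_one_mul] at *
  omega

theorem exists_slot_of_child (hd : 2 ≤ d) {k k' : Fin (p + 1)} (hk : (k' : ℕ) = k + 1) {s t t' : ℕ}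
    (ht : t < len d (level k : Strand p Γ)) (ht' : t' < len d (level k' : Strand p Γ))
    (h : t' / d = t) (h1 : lo d (level k : Strand p Γ) t ≤ s)
    (h2 : s ≤ hi d (level k : Strand p Γ) t) :
    ∃ r : Fin d, (vertex d (level k) (s / d ^ (p - (k : ℕ))),
      vertex d (climb (k + 1)) (s / d ^ (p - (k : ℕ)) * d + r)) =
      ((⟨level k, t, ht⟩, ⟨level k', t', ht'⟩) : Net p Γ d × Net p Γ d) := by
  refine ⟨⟨t' % d, Nat.mod_lt _ (by omega)⟩, ?_⟩
  rw [div_pow_eq hd h1 h2, climb_eq hk]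
  have : t * d + t' % d = t' := by rw [← h]; exact Nat.div_add_mod' t' d
  simp only [this]
  exact Prod.ext (vertex_self ⟨level k, t, ht⟩) (vertex_self ⟨level k', t', ht'⟩)

theorem exists_slotLo (hd : 2 ≤ d) (s : ℕ) (v w : Net p Γ d) (hadj : (netGraph p Γ d).Adj v w)
    (h1 : lo d v.1 v.2 < s) (h2 : s < lo d w.1 w.2) : ∃ i, slotLo s i = (v, w) := by
  obtain ⟨a, t, ht⟩ := v
  obtain ⟨b, t', ht'⟩ := w
  simp only at h1 h2
  rcases (netGraph_adj.1 hadj).2 with h | h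
  · simp only at h
    cases h with
    | step h =>
      subst h
      rcases a with _ | k | ⟨i, c, (_ | _)⟩
      · simp only [lo] at h1 h2; omega
      · refine ⟨(k, .inr 0), ?_⟩
        have := div_pow_eq (Γ := Γ) hd (k := k) (t := t) h1.le (by
          simp only [lo, hi] at h2 ⊢; omega)
        simp only [slotLo, this]
        exact Prod.ext (vertex_self ⟨level k, t, ht⟩) (vertex_self ⟨level k, t + 1, ht'⟩)
      · simp only [lo] at h1 h2; omega
      · simp only [lo] at h1 h2; omega
    | east h h' => rw [h.lo_eq] at h1; rw [h'.lo_eq] at h2; omega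
    | west h h' => rw [h.lo_eq] at h1; rw [h'.lo_eq] at h2; omega
    | summit hk h h' => subst h'; simp [lo] at h2
    | wrap hk h h' => subst h'; simp [lo] at h2
    | @child k k' _ _ hk h =>
      obtain ⟨r, hr⟩ := exists_slot_of_child hd hk ht ht' h h1.le
        (h2.le.trans ((lo_le_hi hd _ _).trans (hi_child hd hk h)))
      exact ⟨(k, .inl r), hr⟩
    | leaf hk h => simp only [lo, hk, Nat.sub_self, pow_zero] at h h1 h2; omega
    | @bypass k _ _ hk h h' =>
      obtain rfl : k = 0 := Fin.ext hk
      subst h h'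
      exact ⟨(0, .inr 3), Prod.ext (vertex_self ⟨level 0, 0, ht⟩) (vertex_self ⟨line, _, ht'⟩)⟩
  · simp only at h
    cases h with
    | step h =>
      subst h
      rcases a with _ | k | ⟨i, c, (_ | _)⟩
      · simp only [lo] at h1 h2; omega
      · simp only [lo, add_one_mul] at h1 h2; omega
      · simp only [lo] at h1 h2; omega
      · simp only [lo] at h1 h2; omega
    | east h h' => rw [h.lo_eq] at h2; rw [h'.lo_eq] at h1; omega
    | west h h' => rw [h.lo_eq] at h2; rw [h'.lo_eq] at h1; omega
    | @summit k _ _ hk h h' =>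
      obtain rfl : k = 0 := Fin.ext hk
      obtain rfl : t' = 3 * p + 1 := by omega
      subst h'
      exact ⟨(0, .inr 2), Prod.ext (vertex_self ⟨level 0, 0, ht⟩) (vertex_self ⟨line, _, ht'⟩)⟩
    | @wrap k k' _ _ hk h h' =>
      obtain rfl : t' = d ^ (k : ℕ) - 1 := by omega
      subst h'
      refine ⟨(k, .inr 1), ?_⟩
      simp only [slotLo, climb_eq hk]
      exact Prod.ext (vertex_self ⟨level k', 0, ht⟩) (vertex_self ⟨level k, _, ht'⟩)
    | child hk h => have := lo_child (Γ := Γ) hk h; omega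
    | leaf hk h => simp only [lo, hk, Nat.sub_self, pow_zero] at h h1 h2; omega
    | bypass hk h h' => subst h; simp [lo] at h2

theorem exists_slotHi (hd : 2 ≤ d) (s : ℕ) (v w : Net p Γ d) (hadj : (netGraph p Γ d).Adj v w)
    (h1 : hi d w.1 w.2 < s) (h2 : s < hi d v.1 v.2) : ∃ i, slotHi s i = (v, w) := by
  obtain ⟨a, t, ht⟩ := v
  obtain ⟨b, t', ht'⟩ := w
  simp only at h1 h2
  have hroot : ∀ {k : Fin (p + 1)} {t : ℕ}, (k : ℕ) = 0 → t = 0 →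
      hi d (level k : Strand p Γ) t = d ^ p - 1 := by
    rintro k t hk rfl
    simp [hi, hk]
  rcases (netGraph_adj.1 hadj).2 with h | h
  · simp only at h
    cases h with
    | step h =>
      subst h
      rcases a with _ | k | ⟨i, c, (_ | _)⟩
      · simp only [hi] at h1 h2; omega
      · simp only [hi, add_one_mul] at h1 h2; omega
      · simp only [hi] at h1 h2; omega
      · simp only [hi] at h1 h2; omega
    | east h h' => rw [h.hi_eq] at h2; rw [h'.hi_eq] at h1; omega
    | west h h' => rw [h.hi_eq] at h2; rw [h'.hi_eq] at h1; omega
    | summit hk h h' => rw [hroot hk h'] at h1; simp only [hi] at h2; omega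
    | @wrap k k' _ _ hk h h' =>
      obtain rfl : t = d ^ (k : ℕ) - 1 := by omega
      subst h'
      refine ⟨(k, .inr 1), ?_⟩
      simp only [slotHi, climb_eq hk]
      exact Prod.ext (vertex_self ⟨level k, _, ht⟩) (vertex_self ⟨level k', 0, ht'⟩)
    | @child k k' _ _ hk h =>
      obtain ⟨r, hr⟩ := exists_slot_of_child hd hk ht ht' h
        (((lo_child hk h).trans (lo_le_hi hd _ _)).trans h1.le) h2.le
      exact ⟨(k, .inl r), hr⟩
    | @leaf k _ i c b _ hk h =>
      cases b <;> simp only [lo, hi, hk, Nat.sub_self, pow_zero] at h h1 h2 <;> omega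
    | bypass hk h h' => rw [hroot hk h] at h2; simp only [hi] at h1; omega
  · simp only at h
    cases h with
    | step h =>
      subst h
      rcases a with _ | k | ⟨i, c, (_ | _)⟩
      · simp only [hi] at h1 h2; omega
      · refine ⟨(k, .inr 0), ?_⟩
        have := div_pow_eq (Γ := Γ) hd (k := k) (t := t' + 1) (by
          simp only [lo, hi] at h1 ⊢; omega) h2.le
        simp only [slotHi, this]
        exact Prod.ext (vertex_self ⟨level k, t' + 1, ht⟩) (vertex_self ⟨level k, t', ht'⟩)
      · simp only [hi] at h1 h2; omega
      · simp only [hi] at h1 h2; omega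
    | east h h' => rw [h.hi_eq] at h1; rw [h'.hi_eq] at h2; omega
    | west h h' => rw [h.hi_eq] at h1; rw [h'.hi_eq] at h2; omega
    | summit hk h h' => rw [hroot hk h'] at h2; simp only [hi] at h1; omega
    | @wrap k k' _ _ hk h h' =>
      subst h'
      simp only [hi] at h1 h2
      rw [h, ← pow_add, Nat.add_sub_cancel' (by omega)] at h1
      have : d ^ (p - (k' : ℕ)) ≤ d ^ p := Nat.pow_le_pow_right (by omega) (Nat.sub_le _ _)
      simp only [zero_add, one_mul] at h2
      omega
    | child hk h => have := hi_child (Γ := Γ) hd hk h; omega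
    | @leaf k _ i c b _ hk h =>
      cases b <;> simp only [lo, hi, hk, Nat.sub_self, pow_zero] at h h1 h2 <;> omega
    | bypass hk h h' => rw [hroot hk h] at h1; simp only [hi] at h2; omega

/-! ### The lower bound -/

theorem card_net : Fintype.card (Net p Γ d) =
    3 * p + 2 + ∑ k ∈ Finset.range (p + 1), d ^ k + 4 * Γ * d ^ p := by
  rw [Fintype.card_sigma]
  simp only [Fintype.card_fin]
  rw [← (equivSum p Γ).symm.sum_comp, Fintype.sum_sum_type,
    Fintype.sum_sum_type, Finset.sum_range]
  simp [equivSum, len]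
  ring

/-- A property that holds for the inputs with `x = y` and for no others takes long to verify. -/
theorem le_of_runsIn {B : ℕ} (hp : 1 ≤ p) (hd : 2 ≤ d) (hB : 1 ≤ B)
    (hΓ : Γ = d ^ (p + 1) * p * B) {P : SimpleGraph (Net p Γ d) → Prop}
    (D : Set (Sym2 (Net p Γ d)))
    (hpos : ∀ x, P ((inputGraph p Γ d x x).deleteEdges D))
    (hneg : ∀ x y, x ≠ y → ¬ P ((inputGraph p Γ d x y).deleteEdges D))
    (A : BAlgorithm (netGraph p Γ d) B) (hA : A.Verifies P) {T : ℕ} (hT : A.RunsIn T) :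
    d ^ p ≤ 24 * T := by
  -- The simulation works only for `T` up to half the number of positions, but otherwise `T` is large.
  by_cases h2T : 2 * T ≤ d ^ p - 1
  · have hdp : 2 ≤ d ^ p := hd.trans (Nat.le_self_pow (by omega) d)
    have hcard := A.card_le_of_fooling hA hT
      (fun x y => (inputGraph p Γ d x y).deleteEdges D)
      (fun x y => (SimpleGraph.deleteEdges_le _).trans (inputGraph_le x y)) hpos hneg
      (lo := fun v => lo d v.1 v.2) (hi := fun v => hi d v.1 v.2) (fun v => lo_le_hi hd v.1 v.2) h2T
      ⟨⟨level 0, 0, by simp [len]⟩, by simp [hi]; omega⟩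
      (fun x y y' v hv w => by
        simp only [SimpleGraph.deleteEdges_adj, inputGraph_adj_change_right x y y' v hv w])
      (fun x x' y v hv w => by
        simp only [SimpleGraph.deleteEdges_adj, inputGraph_adj_change_left x x' y v hv w])
      (fun s => ⟨slotLo s, exists_slotLo hd s⟩) (fun s => ⟨slotHi s, exists_slotHi hd s⟩)
    simp only [Fintype.card_fun, Fintype.card_bool, Fintype.card_fin, Fintype.card_prod,
      Fintype.card_sum] at hcard
    -- There are `2 ^ Γ` inputs `x` and at most `3 ^ (2 T (p + 1) (d + 4) B)` transcripts.
    have hexp : 2 ^ Γ ≤ 2 ^ (2 * (2 * T * ((p + 1) * (d + 4)) * B)) :=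
      hcard.trans ((Nat.pow_le_pow_left (by norm_num : 3 ≤ 2 ^ 2) _).trans (by rw [← pow_mul]))
    have hle := (Nat.pow_le_pow_iff_right (by norm_num)).1 hexp
    have hK : (p + 1) * (d + 4) ≤ (2 * p) * (3 * d) := Nat.mul_le_mul (by omega) (by omega)
    have : d ^ p * (d * p * B) ≤ 24 * T * (d * p * B) := by
      calc d ^ p * (d * p * B) = Γ := by rw [hΓ]; ring
        _ ≤ 4 * T * B * ((p + 1) * (d + 4)) := hle.trans (le_of_eq (by ring))
        _ ≤ 4 * T * B * ((2 * p) * (3 * d)) := Nat.mul_le_mul_left _ hK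
        _ = 24 * T * (d * p * B) := by ring
    exact Nat.le_of_mul_le_mul_right this (by positivity)
  · omega

end Network

open Strand in
theorem theorem6p1 :
    ∃ c c₁ c₂ : ℝ, 0 < c ∧ 0 < c₁ ∧ 0 < c₂ ∧
      ∀ p B n : ℕ, 1 ≤ p → 1 ≤ B → (∃ d : ℕ, 2 ≤ d ∧ n = d ^ (2 * p + 1) * p * B) →
        ∃ (V : Type) (_ : Fintype V) (G : SimpleGraph V),
          G.Connected ∧ G.diam = 2 * p + 2 ∧
          c₁ * (n : ℝ) ≤ (Fintype.card V : ℝ) ∧ (Fintype.card V : ℝ) ≤ c₂ * (n : ℝ) ∧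
          RequiresTime G B IsHamiltonianCycleGraph
            (c * ((n : ℝ) / ((p : ℝ) * (B : ℝ))) ^
              ((1 : ℝ) / 2 - 1 / (2 * (2 * (p : ℝ) + 1)))) ∧
          RequiresTime G B SimpleGraph.IsTree
            (c * ((n : ℝ) / ((p : ℝ) * (B : ℝ))) ^
              ((1 : ℝ) / 2 - 1 / (2 * (2 * (p : ℝ) + 1)))) ∧
          RequiresTime G B IsSimplePathGraph
            (c * ((n : ℝ) / ((p : ℝ) * (B : ℝ))) ^
              ((1 : ℝ) / 2 - 1 / (2 * (2 * (p : ℝ) + 1)))) := by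
  refine ⟨1 / 24, 1, 11, by norm_num, by norm_num, by norm_num, ?_⟩
  rintro p B n hp hB ⟨d, hd, hn⟩
  have hbound : (1 / 24 : ℝ) * ((n : ℝ) / ((p : ℝ) * (B : ℝ))) ^
      ((1 : ℝ) / 2 - 1 / (2 * (2 * (p : ℝ) + 1))) = (d : ℝ) ^ p / 24 := by
    have hp0 : (p : ℝ) ≠ 0 := by positivity
    have hB0 : (B : ℝ) ≠ 0 := by positivity
    have h1 : (n : ℝ) / ((p : ℝ) * (B : ℝ)) = (d : ℝ) ^ (2 * p + 1) := by
      rw [hn]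
      push_cast
      field_simp
    have h2 : ((2 * p + 1 : ℕ) : ℝ) * ((1 : ℝ) / 2 - 1 / (2 * (2 * (p : ℝ) + 1))) = (p : ℕ) := by
      push_cast
      field_simp
      ring
    rw [h1, ← Real.rpow_natCast, ← Real.rpow_mul (by positivity), h2, Real.rpow_natCast]
    ring
  rw [hbound]
  obtain ⟨Γ, hΓ⟩ : ∃ Γ, Γ = d ^ (p + 1) * p * B := ⟨_, rfl⟩
  have hΓn : Γ * d ^ p = n := by rw [hΓ, hn]; ring
  have hΓ0 : 0 < Γ := by rw [hΓ]; positivity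
  have hcard := card_net (p := p) (Γ := Γ) (d := d)
  -- The edge that is removed from every input for the two acyclic properties.
  let a : Net p Γ d := ⟨line, 0, by simp [len]⟩
  let b : Net p Γ d := ⟨line, 1, by simp only [len]; omega⟩
  have hab : ∀ x y, (inputGraph p Γ d x y).Adj a b := fun x y =>
    chainGraph_adj.2 ⟨fun h => by simpa [a, b] using congrArg (fun v : Net p Γ d => (v.2 : ℕ)) h,
      Or.inl (Or.inl ⟨rfl, rfl⟩)⟩
  have hreg := fun x y => inputGraph_twoRegular (Γ := Γ) hp hd x y
  have hconn := fun x => inputGraph_self_connected (p := p) (Γ := Γ) hd x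
  have hreal : ∀ T : ℕ, d ^ p ≤ 24 * T → (d : ℝ) ^ p / 24 ≤ T := by
    intro T h
    have : (d : ℝ) ^ p ≤ 24 * T := by exact_mod_cast h
    linarith
  refine ⟨Net p Γ d, inferInstance, netGraph p Γ d, netGraph_connected hd, netGraph_diam hd hΓ0,
    ?_, ?_, ?_, ?_, ?_⟩
  · have : n ≤ Fintype.card (Net p Γ d) := by
      rw [hcard, mul_assoc, hΓn]; omega
    rw [one_mul]
    exact_mod_cast this
  · have h1 : ∑ k ∈ Finset.range (p + 1), d ^ k ≤ (p + 1) * d ^ p := by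
      have := Finset.sum_le_card_nsmul (Finset.range (p + 1)) (fun k => d ^ k) (d ^ p)
        (fun k hk => Nat.pow_le_pow_right (by omega) (by simpa [Nat.lt_succ_iff] using hk))
      simpa using this
    have h2 : p * d ^ p ≤ n := by
      rw [← hΓn, hΓ]
      refine Nat.mul_le_mul_right _ ?_
      calc p = 1 * p * 1 := by ring
        _ ≤ d ^ (p + 1) * p * B := by gcongr; exact Nat.one_le_pow _ _ (by omega)
    have h3 : p ≤ n := le_trans (Nat.le_mul_of_pos_right p (by positivity)) h2
    have h4 : d ^ p ≤ p * d ^ p := Nat.le_mul_of_pos_left _ hp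
    have : Fintype.card (Net p Γ d) ≤ 11 * n := by
      rw [hcard, mul_assoc, hΓn]
      rw [add_one_mul] at h1
      omega
    exact_mod_cast this
  · intro A hA T hT
    refine hreal T (le_of_runsIn hp hd hB hΓ ∅ (fun x => ?_) (fun x y hxy h => ?_) A hA hT)
    · rw [SimpleGraph.deleteEdges_empty]
      exact SimpleGraph.isHamiltonianCycleGraph_of_twoRegular (hreg x x) (hconn x)
    · rw [SimpleGraph.deleteEdges_empty] at h
      exact inputGraph_not_preconnected hd hxy h.preconnected
  · intro A hA T hT
    exact hreal T (le_of_runsIn hp hd hB hΓ {s(a, b)}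
      (fun x => SimpleGraph.isTree_deleteEdges_of_twoRegular (hreg x x) (hconn x) (hab x x))
      (fun x y hxy h => SimpleGraph.not_isAcyclic_deleteEdges_of_twoRegular (hreg x y)
        (inputGraph_not_preconnected hd hxy) a b h.isAcyclic) A hA hT)
  · intro A hA T hT
    exact hreal T (le_of_runsIn hp hd hB hΓ {s(a, b)}
      (fun x => SimpleGraph.isSimplePathGraph_deleteEdges_of_twoRegular (hreg x x) (hconn x)
        (hab x x))
      (fun x y hxy h => SimpleGraph.not_isAcyclic_deleteEdges_of_twoRegular (hreg x y)
        (inputGraph_not_preconnected hd hxy) a b h.1) A hA hT)
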